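/- Consider randomized algorithms for $n$-vertex undirected graphs $G$ on the vertex set $\{1,\dots,n\}$, consisting of a preprocessing phase and a query procedure. In preprocessing, $G$ is given both as an adjacency matrix and as adjacency lists in arbitrary order, and each of the following costs one step: a step of internal computation, a uniformly random choice from a finite range $\{0,\dots,k\}$, and an access to the input (the length of an adjacency list, its $i$-th entry, or an entry of the adjacency matrix). Preprocessing ends with a data structure. Afterwards a query $(u,v)$ is answered deterministically by YES or NO from the data structure and $(u,v)$ alone, without access to $G$, and it is promised that only edges of $G$ are queried; no bound on the query time is imposed. The data structure is a spanning subgraph adjacency oracle of size at most $s$ for $G$ if there is a subgraph $H$ of $G$ with the same connected components as $G$ and with $|E(H)|\le s$ such that for all $u,v$ with $uv\in E(G)$ the answer to $(u,v)$ is YES if and only if $uv\in E(H)$. **Theorem.** Any algorithm that with constant probability builds an $o(n^2)$-size spanning subgraph adjacency oracle in this model needs $\Omega(n)$ preprocessing time. Precisely, for every $p>0$ there is $c>0$ such that for every function $s(n)=o(n^2)$ there is an $n_0$ such that the following holds for all $n\ge n_0$, every algorithm for $n$-vertex graphs and every $T\in\mathbb{N}$. 1. If on every $n$-vertex input graph (with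 every order of its adjacency lists) the algorithm, with probability at least $p$, finishes preprocessing within $T$ steps with a spanning subgraph adjacency oracle of size at most $s(n)$, then $T\ge cn$. 2. The same conclusion $T\ge cn$ holds if this is only required with probability at least $p$ over the random choices of the algorithm and the following random input: choose uniformly at random a set $S$ of $\lfloor n/2\rfloor$ vertices, a vertex $a\in S$ and a vertex $b\notin S$; the graph consists of the clique on $S$, the clique on the complement of $S$ and the edge $ab$, and its adjacency lists are in independent uniformly random orders. -/

import Mathlib

open Filter Asymptotics

/-- An input graph on the vertex set `Fin n`, given both as an adjacency matrix (`graph`) and as an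
array of adjacency lists; the neighbours of a vertex are listed in an arbitrary order. -/
structure GraphInput (n : ℕ) where
  graph : SimpleGraph (Fin n)
  adjList : Fin n → List (Fin n)
  nodup_adjList : ∀ v, (adjList v).Nodup
  mem_adjList : ∀ v w, w ∈ adjList v ↔ graph.Adj v w

/-- Randomized preprocessing procedures for `n`-vertex input graphs that produce a data structure
in `D`. One elementary step is a step of internal computation, the choice of a uniformly random
element of a finite range, or one access to the input: the length of an adjacency list, an entry of
an adjacency list, or an entry of the adjacency matrix. How a procedure continues may depend
arbitrarily on everything it has seen so far. -/
inductive Preprocessing (n : ℕ) (D : Type) : Type where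
  | halt (d : D) : Preprocessing n D
  | compute (next : Preprocessing n D) : Preprocessing n D
  | sample (k : ℕ) (next : Fin (k + 1) → Preprocessing n D) : Preprocessing n D
  | degree (v : Fin n) (next : ℕ → Preprocessing n D) : Preprocessing n D
  | neighbor (v : Fin n) (i : ℕ) (next : Option (Fin n) → Preprocessing n D) : Preprocessing n D
  | adjacent (u v : Fin n) (next : Bool → Preprocessing n D) : Preprocessing n D

/-- Add one elementary step to the running time in an (outcome, running time) distribution. -/
noncomputable def addStep {D : Type} (μ : PMF (D × ℕ)) : PMF (D × ℕ) :=
  μ.map fun x => (x.1, x.2 + 1)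

open Classical in
/-- The joint distribution of the data structure produced on the input `I` and of the running time,
that is, the number of elementary steps. -/
noncomputable def Preprocessing.run {n : ℕ} {D : Type} (I : GraphInput n) :
    Preprocessing n D → PMF (D × ℕ)
  | .halt d => PMF.pure (d, 0)
  | .compute next => addStep (next.run I)
  | .sample k next =>
      addStep ((PMF.uniformOfFintype (Fin (k + 1))).bind fun i => (next i).run I)
  | .degree v next => addStep ((next (I.adjList v).length).run I)
  | .neighbor v i next => addStep ((next ((I.adjList v)[i]?)).run I)
  | .adjacent u v next => addStep ((next (decide (I.graph.Adj u v))).run I)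

/-- An algorithm that builds an oracle for `n`-vertex graphs: a randomized preprocessing phase, and
a deterministic query procedure that sees only the stored data structure and the queried pair,
not the input graph. -/
structure OracleAlgorithm (n : ℕ) where
  Data : Type
  preprocess : Preprocessing n Data
  answer : Data → Fin n → Fin n → Bool

/-- `H` is a spanning subgraph of `G`: a subgraph with the same connected components. -/
def IsSpanningSubgraph {n : ℕ} (H G : SimpleGraph (Fin n)) : Prop :=
  H ≤ G ∧ ∀ u v, H.Reachable u v ↔ G.Reachable u v

/-- The query answers `ans` form an adjacency oracle for `H`, under the promise that only edges of
`G` are queried. -/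
def IsAdjacencyOracle {n : ℕ} (G H : SimpleGraph (Fin n)) (ans : Fin n → Fin n → Bool) : Prop :=
  ∀ u v, G.Adj u v → (ans u v = true ↔ H.Adj u v)

/-- The query answers `ans` form an adjacency oracle for some spanning subgraph of `G` with at most
`s` edges, under the promise that only edges of `G` are queried. -/
def IsSpanningOracle {n : ℕ} (G : SimpleGraph (Fin n)) (s : ℝ) (ans : Fin n → Fin n → Bool) :
    Prop :=
  ∃ H : SimpleGraph (Fin n),
    IsSpanningSubgraph H G ∧ IsAdjacencyOracle G H ans ∧ (H.edgeSet.ncard : ℝ) ≤ s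

/-- The probability that, on the input `I`, preprocessing takes at most `T` steps and builds an
adjacency oracle for a spanning subgraph with at most `s` edges. -/
noncomputable def OracleAlgorithm.successProb {n : ℕ} (A : OracleAlgorithm n) (s : ℝ) (T : ℕ)
    (I : GraphInput n) : ℝ :=
  ((A.preprocess.run I).toOuterMeasure
    {x | x.2 ≤ T ∧ IsSpanningOracle I.graph s (A.answer x.1)}).toReal

/-- The clique on `S` and the clique on the complement of `S`, joined by the edge `ab`. -/
def twoCliques {n : ℕ} (S : Finset (Fin n)) (a b : Fin n) : SimpleGraph (Fin n) where
  Adj u v := u ≠ v ∧ ((u ∈ S ↔ v ∈ S) ∨ (u = a ∧ v = b) ∨ (u = b ∧ v = a))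
  symm := ⟨fun u v h => by
    obtain ⟨h1, h2⟩ := h
    exact ⟨h1.symm, by tauto⟩⟩
  loopless := ⟨fun u h => h.1 rfl⟩

open Classical in
/-- The two cliques joined by an edge, where the neighbours of `v` are listed in the order in which
they occur in the enumeration `σ v` of all the vertices. -/
noncomputable def twoCliquesInput {n : ℕ} (S : Finset (Fin n)) (a b : Fin n)
    (σ : Fin n → Equiv.Perm (Fin n)) : GraphInput n where
  graph := twoCliques S a b
  adjList v := (List.ofFn (σ v)).filter fun w => decide ((twoCliques S a b).Adj v w)
  nodup_adjList v := (List.nodup_ofFn.2 (σ v).injective).filter _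
  mem_adjList v w := by
    simp only [List.mem_filter, List.mem_ofFn, decide_eq_true_eq, and_iff_right_iff_imp]
    intro _
    exact (σ v).surjective w

/-- The triples `(S, a, b)` of a set `S` of `⌊n/2⌋` vertices, a vertex `a` in `S` and a vertex `b`
outside `S`. -/
def cliqueCuts (n : ℕ) : Finset (Finset (Fin n) × Fin n × Fin n) :=
  Finset.univ.filter fun x => x.1.card = n / 2 ∧ x.2.1 ∈ x.1 ∧ x.2.2 ∉ x.1

/-- The success probability on the random input that consists of two cliques on the two sides of a
uniformly random partition of the vertices into parts of sizes `⌊n/2⌋` and `⌈n/2⌉`, joined by a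
uniformly random edge between the parts, with independent, uniformly random orders of the
adjacency lists. -/
noncomputable def OracleAlgorithm.cliqueSuccessProb {n : ℕ} (A : OracleAlgorithm n) (s : ℝ)
    (T : ℕ) : ℝ :=
  (∑ x ∈ cliqueCuts n, ∑ σ : Fin n → Equiv.Perm (Fin n),
      A.successProb s T (twoCliquesInput x.1 x.2.1 x.2.2 σ)) /
    ((cliqueCuts n).card * Fintype.card (Fin n → Equiv.Perm (Fin n)))

/-! The bridge is hidden among decoys. Take `k + 1` disjoint pairs of vertices, namely the bridge
and `k` pairs inside the clique on `S`, and relabel all vertices at random. As long as no access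
involves one of these vertices, exchanging the bridge with a decoy is invisible. A correct oracle
says YES on the bridge, the only link between the cliques, so a success falls under one of three
events. (1) Nothing is touched and no decoy gets YES. The bridge is then singled out among `k + 1`
indistinguishable pairs, which has probability at most `1 / (k + 1)` (`sum_payoff_onlyFirst_le`).
(2) Some decoy gets YES from a sparse oracle. A decoy is a uniformly random pair in `S` without the
bridge endpoint, so this has probability `O(k * s / n ^ 2)`, which tends to `0`
(`sum_payoff_sparseYes_le`). (3) One of the `2 * k + 2` vertices is touched. Up to the first touch
the bridge may be deleted; then each of them is uniform on its side, and a step touches at most two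
vertices, so the probability is `O(k * T / n)` (`sum_touch_verts_le`). With `k` about `4 / p`, event
(3) must have probability at least `p / 2`, whence `T = Ω(n)`. The worst-case claim follows from the
average-case one. The function `payoff` replaces conditioning on the absence of touches. -/

/-! ### Payoffs and touched vertices -/

/-- The time-limited version of a function of the remaining time: one step is used up. -/
noncomputable def afterStep (F : ℕ → ℝ) : ℕ → ℝ
  | 0 => 0
  | T + 1 => F T

open Classical in
/-- The expected payoff of preprocessing on the input `I` within a given number of steps: `c` if
an access to the input involves a vertex of `R`, otherwise `g d` if preprocessing halts with the
data structure `d`, and `0` if the time is exceeded before. -/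
noncomputable def Preprocessing.payoff {n : ℕ} {D : Type} (I : GraphInput n)
    (R : Finset (Fin n)) (c : ℝ) (g : D → ℝ) : Preprocessing n D → ℕ → ℝ
  | .halt d => fun _ => g d
  | .compute next => afterStep (next.payoff I R c g)
  | .sample k next => afterStep fun T => (∑ i, (next i).payoff I R c g T) / (k + 1)
  | .degree v next => afterStep fun T =>
      if Disjoint {v} R then (next (I.adjList v).length).payoff I R c g T else c
  | .neighbor v i next => afterStep fun T =>
      if Disjoint (insert v ((I.adjList v)[i]?).toFinset) R then
        (next ((I.adjList v)[i]?)).payoff I R c g T else c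
  | .adjacent u v next => afterStep fun T =>
      if Disjoint {u, v} R then (next (decide (I.graph.Adj u v))).payoff I R c g T else c

namespace Preprocessing

variable {n : ℕ} {D : Type}

theorem payoff_mono (I : GraphInput n) (R : Finset (Fin n)) {c c' : ℝ} {g g' : D → ℝ}
    (hc : c ≤ c') (hg : ∀ d, g d ≤ g' d) (q : Preprocessing n D) (T : ℕ) :
    q.payoff I R c g T ≤ q.payoff I R c' g' T := by
  induction q generalizing T with
  | halt d => exact hg d
  | compute next ih => cases T <;> simp [payoff, afterStep, ih]
  | sample k next ih =>
    cases T with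
    | zero => simp [payoff, afterStep]
    | succ T =>
      simp only [payoff, afterStep]
      gcongr
      exact ih _ _
  | degree v next ih =>
    cases T with
    | zero => simp [payoff, afterStep]
    | succ T => simp only [payoff, afterStep]; split_ifs <;> [exact ih _ _; exact hc]
  | neighbor v i next ih =>
    cases T with
    | zero => simp [payoff, afterStep]
    | succ T => simp only [payoff, afterStep]; split_ifs <;> [exact ih _ _; exact hc]
  | adjacent u v next ih =>
    cases T with
    | zero => simp [payoff, afterStep]
    | succ T => simp only [payoff, afterStep]; split_ifs <;> [exact ih _ _; exact hc]

theorem payoff_add (I : GraphInput n) (R : Finset (Fin n)) (c c' : ℝ) (g g' : D → ℝ)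
    (q : Preprocessing n D) (T : ℕ) :
    q.payoff I R (c + c') (fun d => g d + g' d) T =
      q.payoff I R c g T + q.payoff I R c' g' T := by
  induction q generalizing T with
  | halt d => rfl
  | compute next ih => cases T <;> simp [payoff, afterStep, ih]
  | sample k next ih =>
    cases T <;> simp [payoff, afterStep, ih, Finset.sum_add_distrib, add_div]
  | degree v next ih =>
    cases T with
    | zero => simp [payoff, afterStep]
    | succ T => simp only [payoff, afterStep]; split_ifs <;> [exact ih _ _; rfl]
  | neighbor v i next ih =>
    cases T with
    | zero => simp [payoff, afterStep]
    | succ T => simp only [payoff, afterStep]; split_ifs <;> [exact ih _ _; rfl]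
  | adjacent u v next ih =>
    cases T with
    | zero => simp [payoff, afterStep]
    | succ T => simp only [payoff, afterStep]; split_ifs <;> [exact ih _ _; rfl]

theorem payoff_zero (I : GraphInput n) (R : Finset (Fin n)) (q : Preprocessing n D) (T : ℕ) :
    q.payoff I R 0 (fun _ => 0) T = 0 := by
  have := payoff_add I R 0 0 (fun _ => 0) (fun _ => 0) q T
  simp only [add_zero] at this
  linarith

/-- The touch payoff is `0` here, since a nonzero one would be counted once per index. -/
theorem payoff_sum {ι : Type*} (A : Finset ι) (I : GraphInput n) (R : Finset (Fin n))
    (g : ι → D → ℝ) (q : Preprocessing n D) (T : ℕ) :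
    q.payoff I R 0 (fun d => ∑ j ∈ A, g j d) T = ∑ j ∈ A, q.payoff I R 0 (g j) T := by
  classical
  induction A using Finset.induction_on with
  | empty => simpa using payoff_zero I R q T
  | insert j A hj ih =>
    simp only [Finset.sum_insert hj, ← ih]
    simpa using payoff_add I R 0 0 (g j) (fun d => ∑ j ∈ A, g j d) q T

theorem payoff_nonneg (I : GraphInput n) (R : Finset (Fin n)) {c : ℝ} {g : D → ℝ}
    (hc : 0 ≤ c) (hg : ∀ d, 0 ≤ g d) (q : Preprocessing n D) (T : ℕ) :
    0 ≤ q.payoff I R c g T :=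
  (payoff_zero I R q T).symm.trans_le (payoff_mono I R hc hg q T)

theorem payoff_le (I : GraphInput n) (R : Finset (Fin n)) {b c : ℝ} {g : D → ℝ}
    (hb : 0 ≤ b) (hc : c ≤ b) (hg : ∀ d, g d ≤ b) (q : Preprocessing n D) (T : ℕ) :
    q.payoff I R c g T ≤ b := by
  induction q generalizing T with
  | halt d => exact hg d
  | compute next ih => cases T <;> simp [payoff, afterStep, ih, hb]
  | sample k next ih =>
    cases T with
    | zero => simpa [payoff, afterStep]
    | succ T =>
      simp only [payoff, afterStep]
      rw [div_le_iff₀ (by positivity)]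
      refine (Finset.sum_le_sum fun i _ => ih i T).trans ?_
      simp [mul_comm]
  | degree v next ih =>
    cases T with
    | zero => simpa [payoff, afterStep]
    | succ T => simp only [payoff, afterStep]; split_ifs <;> [exact ih _ _; exact hc]
  | neighbor v i next ih =>
    cases T with
    | zero => simpa [payoff, afterStep]
    | succ T => simp only [payoff, afterStep]; split_ifs <;> [exact ih _ _; exact hc]
  | adjacent u v next ih =>
    cases T with
    | zero => simpa [payoff, afterStep]
    | succ T => simp only [payoff, afterStep]; split_ifs <;> [exact ih _ _; exact hc]

/-- Both sides run alike until `R` is touched; from then on the right side is `1`, which bounds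
anything the left side can still earn. -/
theorem payoff_empty_le (I : GraphInput n) (R : Finset (Fin n)) (c : ℝ) {g : D → ℝ}
    (hg : ∀ d, g d ≤ 1) (q : Preprocessing n D) (T : ℕ) :
    q.payoff I ∅ c g T ≤ q.payoff I R 1 g T := by
  have key (q : Preprocessing n D) (T : ℕ) : q.payoff I ∅ c g T ≤ 1 := by
    -- Nothing meets the empty set, so the arbitrary `c` is never paid and may be replaced by `0`.
    have : ∀ c', q.payoff I ∅ c g T = q.payoff I ∅ c' g T := by
      intro c'
      induction q generalizing T with
      | halt d => rfl
      | compute next ih => cases T <;> simp [payoff, afterStep, ih]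
      | sample k next ih => cases T <;> simp [payoff, afterStep, ih]
      | degree v next ih => cases T <;> simp [payoff, afterStep, ih]
      | neighbor v i next ih => cases T <;> simp [payoff, afterStep, ih]
      | adjacent u v next ih => cases T <;> simp [payoff, afterStep, ih]
    exact (this 0).trans_le (payoff_le I ∅ zero_le_one zero_le_one hg q T)
  induction q generalizing T with
  | halt d => exact le_rfl
  | compute next ih => cases T <;> simp [payoff, afterStep, ih]
  | sample k next ih =>
    cases T with
    | zero => simp [payoff, afterStep]
    | succ T =>
      simp only [payoff, afterStep]
      gcongr
      exact ih _ _
  | degree v next ih =>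
    cases T with
    | zero => simp [payoff, afterStep]
    | succ T =>
      simp only [payoff, afterStep, Finset.disjoint_empty_right, if_true]
      split_ifs <;> [exact ih _ _; exact key _ _]
  | neighbor v i next ih =>
    cases T with
    | zero => simp [payoff, afterStep]
    | succ T =>
      simp only [payoff, afterStep, Finset.disjoint_empty_right, if_true]
      split_ifs <;> [exact ih _ _; exact key _ _]
  | adjacent u v next ih =>
    cases T with
    | zero => simp [payoff, afterStep]
    | succ T =>
      simp only [payoff, afterStep, Finset.disjoint_empty_right, if_true]
      split_ifs <;> [exact ih _ _; exact key _ _]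

/-- Induction step of the union bound: if the access meets `R` in `w`, the summand of `w` alone is
`1`. -/
theorem touch_step_le {R A : Finset (Fin n)} {x : ℝ} {y : Fin n → ℝ}
    [∀ B : Finset (Fin n), Decidable (Disjoint A B)]
    (hy : ∀ w, 0 ≤ y w) (h : x ≤ ∑ w ∈ R, y w) :
    (if Disjoint A R then x else 1) ≤ ∑ w ∈ R, if Disjoint A {w} then y w else 1 := by
  split_ifs with hA
  · refine h.trans_eq (Finset.sum_congr rfl fun w hw => (if_pos ?_).symm)
    exact Finset.disjoint_singleton_right.2 (Finset.disjoint_right.1 hA hw)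
  · obtain ⟨w, hwA, hwR⟩ := Finset.not_disjoint_iff.1 hA
    have h0 : ∀ w ∈ R, (0 : ℝ) ≤ if Disjoint A {w} then y w else 1 := by
      intro w _
      split_ifs <;> [exact hy w; exact zero_le_one]
    refine le_trans ?_ (Finset.single_le_sum h0 hwR)
    rw [if_neg (by simpa using hwA)]

/-- The probability of touching `R` is at most the sum of those of touching its elements. -/
theorem touch_le_sum (I : GraphInput n) (R : Finset (Fin n)) (q : Preprocessing n D) (T : ℕ) :
    q.payoff I R 1 (fun _ => 0) T ≤ ∑ w ∈ R, q.payoff I {w} 1 (fun _ => 0) T := by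
  have h0 (q : Preprocessing n D) (T : ℕ) (w : Fin n) :
      0 ≤ q.payoff I {w} 1 (fun _ => 0) T :=
    payoff_nonneg I {w} zero_le_one (fun _ => le_rfl) q T
  induction q generalizing T with
  | halt d => simp [payoff]
  | compute next ih => cases T <;> simp [payoff, afterStep, ih]
  | sample k next ih =>
    cases T with
    | zero => simp [payoff, afterStep]
    | succ T =>
      simp only [payoff, afterStep]
      rw [← Finset.sum_div, Finset.sum_comm]
      gcongr
      exact ih _ _
  | degree v next ih =>
    cases T with
    | zero => simp [payoff, afterStep]
    | succ T => exact touch_step_le (h0 _ T) (ih _ T)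
  | neighbor v i next ih =>
    cases T with
    | zero => simp [payoff, afterStep]
    | succ T => exact touch_step_le (h0 _ T) (ih _ T)
  | adjacent u v next ih =>
    cases T with
    | zero => simp [payoff, afterStep]
    | succ T => exact touch_step_le (h0 _ T) (ih _ T)

theorem touch_step_sum_le {A : Finset (Fin n)} {b : ℝ} {y : Fin n → ℝ}
    [∀ B : Finset (Fin n), Decidable (Disjoint A B)] (hA : A.card ≤ 2)
    (hy : ∀ w, 0 ≤ y w) (h : ∑ w, y w ≤ b) :
    (∑ w, if Disjoint A {w} then y w else 1) ≤ b + 2 := by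
  have : ∀ w, (if Disjoint A {w} then y w else 1) ≤ y w + if w ∈ A then 1 else 0 := by
    intro w
    have := hy w
    by_cases hw : w ∈ A <;> simp [hw, this]
  refine (Finset.sum_le_sum fun w _ => this w).trans ?_
  rw [Finset.sum_add_distrib]
  refine add_le_add h ?_
  simpa using hA

/-- At most two vertices are touched per step. -/
theorem sum_touch_le (I : GraphInput n) (q : Preprocessing n D) (T : ℕ) :
    ∑ w, q.payoff I {w} 1 (fun _ => 0) T ≤ 2 * T := by
  have h0 (q : Preprocessing n D) (T : ℕ) (w : Fin n) :
      0 ≤ q.payoff I {w} 1 (fun _ => 0) T :=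
    payoff_nonneg I {w} zero_le_one (fun _ => le_rfl) q T
  have hs (T : ℕ) : 2 * ((T + 1 : ℕ) : ℝ) = 2 * T + 2 := by push_cast; ring
  induction q generalizing T with
  | halt d => simp [payoff]
  | compute next ih =>
    cases T with
    | zero => simp [payoff, afterStep]
    | succ T => rw [hs]; exact (ih T).trans (by linarith)
  | sample k next ih =>
    cases T with
    | zero => simp [payoff, afterStep]
    | succ T =>
      simp only [payoff, afterStep]
      rw [← Finset.sum_div, Finset.sum_comm, div_le_iff₀ (by positivity)]
      refine (Finset.sum_le_sum fun i _ => ih i T).trans ?_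
      rw [hs]
      simp only [Finset.sum_const, Finset.card_univ, Fintype.card_fin, nsmul_eq_mul]
      push_cast
      nlinarith
  | degree v next ih =>
    cases T with
    | zero => simp [payoff, afterStep]
    | succ T => rw [hs]; exact touch_step_sum_le (by simp) (h0 _ T) (ih _ T)
  | neighbor v i next ih =>
    cases T with
    | zero => simp [payoff, afterStep]
    | succ T =>
      rw [hs]
      refine touch_step_sum_le ?_ (h0 _ T) (ih _ T)
      refine (Finset.card_insert_le _ _).trans ?_
      cases (I.adjList v)[i]? <;> simp
  | adjacent u v next ih =>
    cases T with
    | zero => simp [payoff, afterStep]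
    | succ T => rw [hs]; exact touch_step_sum_le Finset.card_le_two (h0 _ T) (ih _ T)

end Preprocessing

/-! ### Indistinguishable inputs -/

/-- The inputs `I` and `I'` look the same to a procedure as long as it does not touch `R`. -/
def AgreeOff {n : ℕ} (R : Finset (Fin n)) (I I' : GraphInput n) : Prop :=
  (∀ v ∉ R, (I.adjList v).length = (I'.adjList v).length ∧
    ∀ i : ℕ, (I.adjList v)[i]? = (I'.adjList v)[i]? ∨
      ∃ w ∈ R, ∃ w' ∈ R, (I.adjList v)[i]? = some w ∧ (I'.adjList v)[i]? = some w') ∧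
  ∀ u ∉ R, ∀ v ∉ R, I.graph.Adj u v ↔ I'.graph.Adj u v

/-- Run in parallel, the two executions get equal answers until the first touch of `R`, which they
make at the same step: list entries differ only where both lie in `R`. -/
theorem AgreeOff.payoff_eq {n : ℕ} {D : Type} {R : Finset (Fin n)} {I I' : GraphInput n}
    (h : AgreeOff R I I') (c : ℝ) (g : D → ℝ) (q : Preprocessing n D) (T : ℕ) :
    q.payoff I R c g T = q.payoff I' R c g T := by
  induction q generalizing T with
  | halt d => rfl
  | compute next ih => cases T <;> simp [Preprocessing.payoff, afterStep, ih]
  | sample k next ih => cases T <;> simp [Preprocessing.payoff, afterStep, ih]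
  | degree v next ih =>
    cases T with
    | zero => rfl
    | succ T =>
      simp only [Preprocessing.payoff, afterStep]
      split_ifs with hv
      · rw [(h.1 v (by simpa using hv)).1, ih]
      · rfl
  | neighbor v i next ih =>
    cases T with
    | zero => rfl
    | succ T =>
      simp only [Preprocessing.payoff, afterStep]
      by_cases hv : v ∈ R
      · simp [hv]
      rcases (h.1 v hv).2 i with he | ⟨w, hw, w', hw', he, he'⟩
      · rw [he, ih]
      · simp [he, he', hw, hw']
  | adjacent u v next ih =>
    cases T with
    | zero => rfl
    | succ T =>
      simp only [Preprocessing.payoff, afterStep]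
      by_cases hu : u ∈ R
      · simp [hu]
      by_cases hv : v ∈ R
      · simp [hv]
      have := h.2 u hu v hv
      by_cases ha : I.graph.Adj u v
      · simp [ih, ha, this.1 ha]
      · simp [ih, ha, mt this.2 ha]

/-! ### From output distributions to payoffs -/

theorem PMF.toOuterMeasure_ne_top {α : Type*} (μ : PMF α) (s : Set α) :
    μ.toOuterMeasure s ≠ ⊤ := by
  have h : μ.toOuterMeasure Set.univ = 1 :=
    (μ.toOuterMeasure_apply_eq_one_iff Set.univ).2 (Set.subset_univ _)
  exact ne_top_of_le_ne_top ENNReal.one_ne_top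
    ((μ.toOuterMeasure.mono (Set.subset_univ s)).trans_eq h)

theorem addStep_toReal {D : Type} (μ : PMF (D × ℕ)) (P : D → Prop) (F : ℕ → ℝ)
    (h : ∀ T, (μ.toOuterMeasure {x | x.2 ≤ T ∧ P x.1}).toReal = F T) (T : ℕ) :
    ((addStep μ).toOuterMeasure {x | x.2 ≤ T ∧ P x.1}).toReal = afterStep F T := by
  rw [addStep, PMF.toOuterMeasure_map_apply]
  cases T with
  | zero => simp [afterStep]
  | succ T => simp [afterStep, ← h T]

open Classical in
theorem Preprocessing.run_toReal {n : ℕ} {D : Type} (I : GraphInput n) (P : D → Prop)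
    (q : Preprocessing n D) (T : ℕ) :
    ((q.run I).toOuterMeasure {x | x.2 ≤ T ∧ P x.1}).toReal =
      q.payoff I ∅ 0 (fun d => if P d then 1 else 0) T := by
  induction q generalizing T with
  | halt d =>
    simp only [Preprocessing.run, Preprocessing.payoff, PMF.toOuterMeasure_pure_apply]
    by_cases h : P d <;> simp [h]
  | compute next ih => exact addStep_toReal _ P _ ih T
  | sample k next ih =>
    refine addStep_toReal _ P _ (fun T => ?_) T
    rw [PMF.toOuterMeasure_bind_apply, tsum_fintype, ENNReal.toReal_sum, Finset.sum_div]
    · refine Finset.sum_congr rfl fun i _ => ?_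
      rw [ENNReal.toReal_mul, ih i T, PMF.uniformOfFintype_apply, div_eq_inv_mul, Fintype.card_fin,
        ENNReal.toReal_inv, ENNReal.toReal_natCast, Nat.cast_add_one]
    · exact fun i _ => ENNReal.mul_ne_top (PMF.apply_ne_top _ _) (PMF.toOuterMeasure_ne_top _ _)
  | degree v next ih =>
    simp only [Preprocessing.payoff, Finset.disjoint_empty_right, if_true]
    exact addStep_toReal _ P _ (ih _) T
  | neighbor v i next ih =>
    simp only [Preprocessing.payoff, Finset.disjoint_empty_right, if_true]
    exact addStep_toReal _ P _ (ih _) T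
  | adjacent u v next ih =>
    simp only [Preprocessing.payoff, Finset.disjoint_empty_right, if_true]
    exact addStep_toReal _ P _ (ih _) T

/-! ### Two cliques and their spanning oracles -/

/-- The case `a = b` encodes the absence of a bridge, since loops are excluded. -/
theorem twoCliques_adj_of_ne {n : ℕ} {S : Finset (Fin n)} {a b v : Fin n}
    (h : a = b ∨ v ≠ a ∧ v ≠ b) (w : Fin n) :
    (twoCliques S a b).Adj v w ↔ v ≠ w ∧ (v ∈ S ↔ w ∈ S) := by
  simp only [twoCliques]
  constructor
  · rintro ⟨h1, h2⟩
    refine ⟨h1, h2.resolve_right ?_⟩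
    rintro (⟨rfl, rfl⟩ | ⟨rfl, rfl⟩) <;> simp_all
  · tauto

/-- Relabelling the vertices of `R` and changing the bridge inside `R` is only noticed by touching
`R`. -/
theorem agreeOff_twoCliquesInput {n : ℕ} {R S : Finset (Fin n)} {a b a' b' : Fin n}
    (σ : Fin n → Equiv.Perm (Fin n)) (π : Equiv.Perm (Fin n)) (hπ : ∀ w ∉ R, π w = w)
    (h : a = b ∨ a ∈ R ∧ b ∈ R) (h' : a' = b' ∨ a' ∈ R ∧ b' ∈ R) :
    AgreeOff R (twoCliquesInput S a b σ)
      (twoCliquesInput (S.map π.toEmbedding) a' b' fun v => (σ v).trans π) := by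
  have hS : ∀ w, π w ∈ S.map π.toEmbedding ↔ w ∈ S := by simp
  have hS' : ∀ v ∉ R, v ∈ S.map π.toEmbedding ↔ v ∈ S := fun v hv => by
    conv_lhs => rw [← hπ v hv, hS]
  have hadj (v : Fin n) (hv : v ∉ R) (w : Fin n) :
      (twoCliques (S.map π.toEmbedding) a' b').Adj v (π w) ↔ (twoCliques S a b).Adj v w := by
    rw [twoCliques_adj_of_ne (h.imp_right fun h => ⟨ne_of_mem_of_not_mem h.1 hv |>.symm,
      ne_of_mem_of_not_mem h.2 hv |>.symm⟩),
      twoCliques_adj_of_ne (h'.imp_right fun h => ⟨ne_of_mem_of_not_mem h.1 hv |>.symm,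
      ne_of_mem_of_not_mem h.2 hv |>.symm⟩), hS, hS' v hv]
    nth_rw 1 [← hπ v hv]
    rw [π.injective.ne_iff]
  have hlist (v : Fin n) (hv : v ∉ R) :
      (twoCliquesInput (S.map π.toEmbedding) a' b' fun v => (σ v).trans π).adjList v =
        ((twoCliquesInput S a b σ).adjList v).map π := by
    have : List.ofFn ((σ v).trans π) = (List.ofFn (σ v)).map π := by
      rw [List.map_ofFn]; rfl
    simp only [twoCliquesInput, this, List.filter_map]
    congr 2
    funext w
    exact decide_eq_decide.2 (hadj v hv w)
  refine ⟨fun v hv => ?_, fun u hu v hv => ?_⟩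
  · rw [hlist v hv]
    refine ⟨by simp, fun i => ?_⟩
    rw [List.getElem?_map]
    cases hw : ((twoCliquesInput S a b σ).adjList v)[i]? with
    | none => simp
    | some w =>
      by_cases hwR : w ∈ R
      · refine Or.inr ⟨w, hwR, π w, ?_, rfl, rfl⟩
        -- `π` preserves `R`: if `π w` were outside, it would be fixed by `π`, and injectivity would
        -- give `π w = w`.
        by_contra hc
        exact hc (by rwa [π.injective (hπ _ hc)])
      · simp [hπ w hwR]
  · have := hadj u hu v
    rw [hπ v hv] at this
    exact this.symm

/-- Without the bridge, membership in `S` is constant along walks of `H`, so `H` could not connect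
`a` to `b`. -/
theorem IsSpanningOracle.answer_bridge {n : ℕ} {S : Finset (Fin n)} {a b : Fin n} {s : ℝ}
    {ans : Fin n → Fin n → Bool} (ha : a ∈ S) (hb : b ∉ S)
    (h : IsSpanningOracle (twoCliques S a b) s ans) : ans a b = true := by
  obtain ⟨H, ⟨hle, hreach⟩, horacle, -⟩ := h
  have hab : (twoCliques S a b).Adj a b :=
    ⟨ne_of_mem_of_not_mem ha hb, Or.inr (Or.inl ⟨rfl, rfl⟩)⟩
  rw [horacle a b hab]
  by_contra hH
  obtain ⟨p⟩ := (hreach a b).2 hab.reachable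
  have key {x y : Fin n} (p : H.Walk x y) : x ∈ S ↔ y ∈ S := by
    induction p with
    | nil => rfl
    | cons hxy _ ih =>
      rw [← ih]
      rcases (hle hxy).2 with h | ⟨rfl, rfl⟩ | ⟨rfl, rfl⟩
      · exact h
      · exact (hH hxy).elim
      · exact (hH hxy.symm).elim
  exact hb ((key p).1 ha)

-- Restricting to adjacent pairs is essential, because answers on non-edges are arbitrary. The
-- factor `2` counts the two orientations of an edge.
open Classical in
theorem IsSpanningOracle.card_le {n : ℕ} {G : SimpleGraph (Fin n)} {s : ℝ}
    {ans : Fin n → Fin n → Bool} (h : IsSpanningOracle G s ans) :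
    ((Finset.univ.filter fun x : Fin n × Fin n =>
      G.Adj x.1 x.2 ∧ ans x.1 x.2 = true).card : ℝ) ≤ 2 * s := by
  obtain ⟨H, ⟨hle, -⟩, horacle, hs⟩ := h
  have h1 : (Finset.univ.filter fun x : Fin n × Fin n =>
      G.Adj x.1 x.2 ∧ ans x.1 x.2 = true).card ≤ Fintype.card H.Dart := by
    refine (Finset.card_le_card_of_surjOn (s := Finset.univ) (fun d : H.Dart => d.toProd) ?_)
    rintro ⟨x, y⟩ hxy
    simp only [Finset.coe_filter, Set.mem_ofPred_eq, Finset.mem_univ, true_and] at hxy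
    exact ⟨⟨(x, y), (horacle x y hxy.1).1 hxy.2⟩, by simp, rfl⟩
  rw [SimpleGraph.dart_card_eq_twice_card_edges] at h1
  rw [← SimpleGraph.coe_edgeFinset, Set.ncard_coe_finset] at hs
  calc _ ≤ ((2 * H.edgeFinset.card : ℕ) : ℝ) := by exact_mod_cast h1
    _ ≤ 2 * s := by push_cast; linarith

/-! ### Random relabelling -/

/-- The action of the permutations of the vertices on the triples `(S, a, b)`. -/
def relabel {n : ℕ} (ρ : Equiv.Perm (Fin n)) (y : Finset (Fin n) × Fin n × Fin n) :
    Finset (Fin n) × Fin n × Fin n :=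
  (y.1.map ρ.toEmbedding, ρ y.2.1, ρ y.2.2)

theorem relabel_mul {n : ℕ} (ρ τ : Equiv.Perm (Fin n)) (y : Finset (Fin n) × Fin n × Fin n) :
    relabel (ρ * τ) y = relabel ρ (relabel τ y) := by
  simp only [relabel, Finset.map_map, Equiv.Perm.mul_apply]
  rfl

theorem relabel_one {n : ℕ} (y : Finset (Fin n) × Fin n × Fin n) : relabel 1 y = y := by
  obtain ⟨S, a, b⟩ := y
  simp only [relabel, Equiv.Perm.one_apply, Prod.mk.injEq, and_true]
  exact Finset.map_refl

theorem relabel_mem_cliqueCuts {n : ℕ} (ρ : Equiv.Perm (Fin n))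
    {y : Finset (Fin n) × Fin n × Fin n} (hy : y ∈ cliqueCuts n) :
    relabel ρ y ∈ cliqueCuts n := by
  simpa [relabel, cliqueCuts] using hy

theorem map_eq_of_mem_iff {n : ℕ} {S : Finset (Fin n)} {g : Equiv.Perm (Fin n)}
    (h : ∀ w, g w ∈ S ↔ w ∈ S) : S.map g.toEmbedding = S := by
  ext w
  rw [Finset.mem_map_equiv, ← h, Equiv.apply_symm_apply]

theorem swap_mem_iff {n : ℕ} {S : Finset (Fin n)} {x y : Fin n} (h : x ∈ S ↔ y ∈ S) (w : Fin n) :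
    Equiv.swap x y w ∈ S ↔ w ∈ S := by
  rw [Equiv.swap_apply_def]
  split_ifs with h1 h2
  · rw [h1, h]
  · rw [h2, h]
  · rfl

theorem exists_relabel_eq {n : ℕ} {y z : Finset (Fin n) × Fin n × Fin n}
    (hy : y ∈ cliqueCuts n) (hz : z ∈ cliqueCuts n) :
    ∃ g : Equiv.Perm (Fin n), relabel g y = z := by
  obtain ⟨S, a, b⟩ := y
  obtain ⟨S', a', b'⟩ := z
  simp only [cliqueCuts, Finset.mem_filter, Finset.mem_univ, true_and] at hy hz
  have hcard : Fintype.card {x // x ∈ S} = Fintype.card {x // x ∈ S'} := by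
    simp [hy.1, hz.1]
  let e := (Fintype.equivOfCardEq hcard).extendSubtype
  have he : S.map e.toEmbedding = S' := by
    refine Finset.eq_of_subset_of_card_le (fun w hw => ?_) (by simp [hy.1, hz.1])
    obtain ⟨x, hx, rfl⟩ := Finset.mem_map.1 hw
    exact (Fintype.equivOfCardEq hcard).extendSubtype_mem x hx
  have hmem (w : Fin n) : e w ∈ S' ↔ w ∈ S := by rw [← he]; simp
  have ha : e a ∈ S' := (hmem a).2 hy.2.1
  have hb : e b ∉ S' := mt (hmem b).1 hy.2.2
  have h1 : relabel e (S, a, b) = (S', e a, e b) := by simp [relabel, he]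
  -- `e` already carries `S` to `S'`; one swap outside `S'` and one inside it correct the endpoints.
  refine ⟨Equiv.swap (e a) a' * (Equiv.swap (e b) b' * e), ?_⟩
  rw [relabel_mul, relabel_mul, h1]
  simp only [relabel, Equiv.swap_apply_left]
  rw [map_eq_of_mem_iff (swap_mem_iff (iff_of_false hb hz.2.2)),
    map_eq_of_mem_iff (swap_mem_iff (iff_of_true ha hz.2.1)),
    Equiv.swap_apply_of_ne_of_ne (ne_of_mem_of_not_mem ha hb) (ne_of_mem_of_not_mem ha hz.2.2),
    Equiv.swap_apply_left,
    Equiv.swap_apply_of_ne_of_ne (ne_of_mem_of_not_mem ha hz.2.2).symm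
      (ne_of_mem_of_not_mem hz.2.1 hz.2.2).symm]

theorem sum_mul_right {n : ℕ} (τ : Equiv.Perm (Fin n)) (F : Equiv.Perm (Fin n) → ℝ) :
    ∑ ρ, F (ρ * τ) = ∑ ρ, F ρ :=
  Equiv.sum_comp (Equiv.mulRight τ) F

/-- A uniformly random relabelling of a fixed triple is a uniformly random triple. -/
theorem sum_cliqueCuts {n : ℕ} {y : Finset (Fin n) × Fin n × Fin n} (hy : y ∈ cliqueCuts n)
    (F : Finset (Fin n) × Fin n × Fin n → ℝ) :
    (∑ z ∈ cliqueCuts n, F z) * Fintype.card (Equiv.Perm (Fin n)) =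
      (cliqueCuts n).card * ∑ ρ : Equiv.Perm (Fin n), F (relabel ρ y) := by
  have h1 (ρ : Equiv.Perm (Fin n)) :
      ∑ z ∈ cliqueCuts n, F (relabel ρ z) = ∑ z ∈ cliqueCuts n, F z := by
    refine Finset.sum_nbij' (relabel ρ) (relabel ρ⁻¹) (fun z hz => relabel_mem_cliqueCuts ρ hz)
      (fun z hz => relabel_mem_cliqueCuts _ hz) (fun z _ => ?_) (fun z _ => ?_) (fun z _ => rfl)
    · rw [← relabel_mul, inv_mul_cancel, relabel_one]
    · rw [← relabel_mul, mul_inv_cancel, relabel_one]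
  have h2 (z) (hz : z ∈ cliqueCuts n) :
      ∑ ρ, F (relabel ρ z) = ∑ ρ, F (relabel ρ y) := by
    obtain ⟨g, rfl⟩ := exists_relabel_eq hy hz
    simp only [← relabel_mul]
    exact sum_mul_right g fun ρ => F (relabel ρ y)
  -- Double counting: the inner sum is constant by invariance in one order, by transitivity in the
  -- other.
  calc (∑ z ∈ cliqueCuts n, F z) * Fintype.card (Equiv.Perm (Fin n))
      = ∑ ρ : Equiv.Perm (Fin n), ∑ z ∈ cliqueCuts n, F (relabel ρ z) := by
        simp [h1, mul_comm]
    _ = ∑ z ∈ cliqueCuts n, ∑ ρ : Equiv.Perm (Fin n), F (relabel ρ z) := Finset.sum_comm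
    _ = _ := by rw [Finset.sum_congr rfl h2]; simp

/-! ### The bridge among decoy pairs -/

/-- A vertex set `S` and `k + 1` disjoint pairs of vertices, all of them in `S` except for the
second vertex of the first pair. -/
structure PairTemplate (n k : ℕ) where
  S : Finset (Fin n)
  u : Fin (k + 1) → Fin n
  v : Fin (k + 1) → Fin n
  u_mem : ∀ i, u i ∈ S
  v_mem : ∀ i, i ≠ 0 → v i ∈ S
  v_zero : v 0 ∉ S
  u_inj : Function.Injective u
  v_inj : Function.Injective v
  u_ne_v : ∀ i j, u i ≠ v j

namespace PairTemplate

variable {n k : ℕ} (P : PairTemplate n k)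

/-- The vertices of the pairs. -/
def verts : Finset (Fin n) := Finset.univ.image P.u ∪ Finset.univ.image P.v

/-- The two cliques that arise from the template by relabelling, joined at the first pair. -/
noncomputable def input (ρ : Equiv.Perm (Fin n)) (σ : Fin n → Equiv.Perm (Fin n)) : GraphInput n :=
  twoCliquesInput (P.S.map ρ.toEmbedding) (ρ (P.u 0)) (ρ (P.v 0)) σ

/-- The transposition of the first pair and the pair with index `j`. -/
def swapPair (j : Fin (k + 1)) : Equiv.Perm (Fin n) :=
  Equiv.swap (P.u 0) (P.u j) * Equiv.swap (P.v 0) (P.v j)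

theorem u_mem_verts (i : Fin (k + 1)) : P.u i ∈ P.verts := by simp [verts]

theorem v_mem_verts (i : Fin (k + 1)) : P.v i ∈ P.verts := by simp [verts]

theorem swapPair_u (j i : Fin (k + 1)) : P.swapPair j (P.u i) = P.u (Equiv.swap 0 j i) := by
  rw [swapPair, Equiv.Perm.mul_apply,
    Equiv.swap_apply_of_ne_of_ne (P.u_ne_v _ _) (P.u_ne_v _ _), P.u_inj.swap_apply]

theorem swapPair_v (j i : Fin (k + 1)) : P.swapPair j (P.v i) = P.v (Equiv.swap 0 j i) := by
  rw [swapPair, Equiv.Perm.mul_apply, P.v_inj.swap_apply,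
    Equiv.swap_apply_of_ne_of_ne (P.u_ne_v _ _).symm (P.u_ne_v _ _).symm]

theorem swapPair_of_notMem (j : Fin (k + 1)) {w : Fin n} (hw : w ∉ P.verts) :
    P.swapPair j w = w := by
  have hu (i) : w ≠ P.u i := fun h => hw (h ▸ P.u_mem_verts i)
  have hv (i) : w ≠ P.v i := fun h => hw (h ▸ P.v_mem_verts i)
  rw [swapPair, Equiv.Perm.mul_apply, Equiv.swap_apply_of_ne_of_ne (hv _) (hv _),
    Equiv.swap_apply_of_ne_of_ne (hu _) (hu _)]

theorem verts_map_swapPair (ρ : Equiv.Perm (Fin n)) (j : Fin (k + 1)) :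
    P.verts.map (ρ * P.swapPair j).toEmbedding = P.verts.map ρ.toEmbedding := by
  have h : P.verts.map (P.swapPair j).toEmbedding = P.verts := by
    refine Finset.map_perm fun w hw => ?_
    by_contra hc
    exact hw (P.swapPair_of_notMem j hc)
  conv_rhs => rw [← h, Finset.map_map]
  rfl

/-- A procedure that does not touch the pairs does not notice whether they are exchanged. -/
theorem sum_payoff_swapPair {D : Type} (ρ : Equiv.Perm (Fin n)) (j : Fin (k + 1)) (c : ℝ)
    (g : D → ℝ) (q : Preprocessing n D) (T : ℕ) :
    ∑ σ, q.payoff (P.input (ρ * P.swapPair j) σ) (P.verts.map ρ.toEmbedding) c g T =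
      ∑ σ, q.payoff (P.input ρ σ) (P.verts.map ρ.toEmbedding) c g T := by
  set π : Equiv.Perm (Fin n) := ρ * P.swapPair j * ρ⁻¹ with hπ
  -- Uniform list orders are invariant under `π`; relabelling them along with the graph makes the
  -- two inputs agree off the pairs.
  rw [← Equiv.sum_comp (Equiv.piCongrRight fun _ : Fin n => Equiv.mulLeft π)]
  refine Finset.sum_congr rfl fun σ _ => ?_
  refine (AgreeOff.payoff_eq ?_ c g q T).symm
  have hS : P.S.map (ρ * P.swapPair j).toEmbedding =
      (P.S.map ρ.toEmbedding).map π.toEmbedding := by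
    rw [Finset.map_map]
    congr 1
    ext w
    simp [hπ]
  unfold input
  rw [hS]
  refine agreeOff_twoCliquesInput σ π (fun w hw => ?_) (Or.inr ⟨?_, ?_⟩) (Or.inr ⟨?_, ?_⟩)
  · rw [Finset.mem_map_equiv] at hw
    have := P.swapPair_of_notMem j hw
    simp only [hπ, Equiv.Perm.mul_apply]
    erw [this]
    simp
  · simpa using P.u_mem_verts 0
  · simpa using P.v_mem_verts 0
  · simpa [swapPair_u] using P.u_mem_verts j
  · simpa [swapPair_v] using P.v_mem_verts j

open Classical in
/-- The indicator of the event that, among the relabelled pairs, exactly the first one gets a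
positive answer. -/
noncomputable def onlyFirst {D : Type} (ans : D → Fin n → Fin n → Bool) (ρ : Equiv.Perm (Fin n))
    (d : D) : ℝ :=
  if ans d (ρ (P.u 0)) (ρ (P.v 0)) = true ∧
    ∀ i, i ≠ 0 → ¬ ans d (ρ (P.u i)) (ρ (P.v i)) = true then 1 else 0

/-- After the exchange, the `j`-th indicator says that pair `j` is the only one with answer YES;
this holds for at most one `j`. -/
theorem sum_onlyFirst_le {D : Type} (ans : D → Fin n → Fin n → Bool) (ρ : Equiv.Perm (Fin n))
    (d : D) : ∑ j, P.onlyFirst ans (ρ * P.swapPair j) d ≤ 1 := by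
  classical
  simp only [onlyFirst, Finset.sum_boole, Equiv.Perm.mul_apply, swapPair_u, swapPair_v,
    Equiv.swap_apply_left]
  norm_cast
  refine Finset.card_le_one.2 fun i hi j hj => ?_
  simp only [Finset.mem_filter, Finset.mem_univ, true_and] at hi hj
  by_contra hij
  refine hi.2 (Equiv.swap 0 i j) (fun h => hij ?_) ?_
  · rw [Equiv.swap_apply_eq_iff, Equiv.swap_apply_left] at h
    exact h.symm
  · rw [Equiv.swap_apply_self]
    exact hj.1

theorem sum_payoff_onlyFirst_le {D : Type} (ans : D → Fin n → Fin n → Bool)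
    (q : Preprocessing n D) (T : ℕ) :
    ((k : ℝ) + 1) * ∑ ρ, ∑ σ, q.payoff (P.input ρ σ) (P.verts.map ρ.toEmbedding) 0
        (P.onlyFirst ans ρ) T ≤
      Fintype.card (Equiv.Perm (Fin n)) * Fintype.card (Fin n → Equiv.Perm (Fin n)) := by
  have h (j : Fin (k + 1)) :
      ∑ ρ, ∑ σ, q.payoff (P.input ρ σ) (P.verts.map ρ.toEmbedding) 0 (P.onlyFirst ans ρ) T =
      ∑ ρ, ∑ σ, q.payoff (P.input ρ σ) (P.verts.map ρ.toEmbedding) 0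
        (P.onlyFirst ans (ρ * P.swapPair j)) T := by
    -- The substitution changes both the input and the indicator; `sum_payoff_swapPair` then
    -- restores the input only.
    rw [← sum_mul_right (P.swapPair j)]
    refine Finset.sum_congr rfl fun ρ _ => ?_
    rw [verts_map_swapPair, sum_payoff_swapPair]
  calc _ = ∑ j : Fin (k + 1), ∑ ρ, ∑ σ, q.payoff (P.input ρ σ) (P.verts.map ρ.toEmbedding) 0
        (P.onlyFirst ans (ρ * P.swapPair j)) T := by
        rw [← Finset.sum_congr rfl fun j _ => h j]; simp
    _ = ∑ ρ, ∑ σ, q.payoff (P.input ρ σ) (P.verts.map ρ.toEmbedding) 0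
        (fun d => ∑ j, P.onlyFirst ans (ρ * P.swapPair j) d) T := by
        rw [Finset.sum_comm]
        refine Finset.sum_congr rfl fun ρ _ => ?_
        rw [Finset.sum_comm]
        exact Finset.sum_congr rfl fun σ _ => (Preprocessing.payoff_sum _ _ _ _ q T).symm
    _ ≤ ∑ ρ : Equiv.Perm (Fin n), ∑ σ : Fin n → Equiv.Perm (Fin n), (1 : ℝ) := by
        gcongr with ρ _ σ _
        exact Preprocessing.payoff_le _ _ zero_le_one zero_le_one (P.sum_onlyFirst_le ans ρ) q T
    _ = _ := by simp

open Classical in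
/-- The indicator of the event that at most `2 * s` ordered pairs of adjacent vertices get a
positive answer, and that the relabelled pair `(x, y)` gets one. -/
noncomputable def sparseYes {D : Type} (ans : D → Fin n → Fin n → Bool) (s : ℝ)
    (ρ : Equiv.Perm (Fin n)) (x y : Fin n) (d : D) : ℝ :=
  if ((Finset.univ.filter fun z : Fin n × Fin n =>
      (twoCliques (P.S.map ρ.toEmbedding) (ρ (P.u 0)) (ρ (P.v 0))).Adj z.1 z.2 ∧
        ans d z.1 z.2 = true).card : ℝ) ≤ 2 * s ∧ ans d (ρ x) (ρ y) = true then 1 else 0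

/-- Pairs inside `S` stay adjacent after relabelling, so they inject into the counted ones. The
absolute value covers negative `s`. -/
theorem sum_sparseYes_le {D : Type} (ans : D → Fin n → Fin n → Bool) (s : ℝ)
    (ρ : Equiv.Perm (Fin n)) (d : D) :
    ∑ z ∈ (P.S.erase (P.u 0)).offDiag, P.sparseYes ans s ρ z.1 z.2 d ≤ 2 * |s| := by
  classical
  unfold sparseYes
  set N := Finset.univ.filter fun z : Fin n × Fin n =>
      (twoCliques (P.S.map ρ.toEmbedding) (ρ (P.u 0)) (ρ (P.v 0))).Adj z.1 z.2 ∧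
        ans d z.1 z.2 = true with hN
  by_cases h : (N.card : ℝ) ≤ 2 * s
  · simp only [h, true_and, Finset.sum_boole]
    have h1 : ((P.S.erase (P.u 0)).offDiag.filter fun z =>
        ans d (ρ z.1) (ρ z.2) = true).card ≤ N.card := by
      refine Finset.card_le_card_of_injOn (Prod.map ρ ρ) ?_
        (ρ.injective.prodMap ρ.injective).injOn
      rintro ⟨x, y⟩ hxy
      simp only [Finset.coe_filter, Finset.mem_offDiag, Finset.mem_erase, Set.mem_ofPred_eq]
        at hxy
      simp only [hN, Finset.coe_filter, Finset.mem_univ, true_and, Set.mem_ofPred_eq, Prod.map]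
      exact ⟨⟨ρ.injective.ne hxy.1.2.2, Or.inl (by simp [hxy.1.1.2, hxy.1.2.1.2])⟩, hxy.2⟩
    calc _ ≤ (N.card : ℝ) := by exact_mod_cast h1
      _ ≤ 2 * s := h
      _ ≤ 2 * |s| := by gcongr; exact le_abs_self s
  · simp [h]

/-- Some permutation `g` moves one pair to the other and fixes `S`, `P.u 0` and `P.v 0`, hence the
input. This is why `P.u 0` is erased from `S`. -/
theorem sum_payoff_sparseYes_eq {D : Type} (ans : D → Fin n → Fin n → Bool) (s : ℝ)
    (q : Preprocessing n D) (T : ℕ) {x y x' y' : Fin n}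
    (h : (x, y) ∈ (P.S.erase (P.u 0)).offDiag) (h' : (x', y') ∈ (P.S.erase (P.u 0)).offDiag) :
    ∑ ρ, ∑ σ, q.payoff (P.input ρ σ) ∅ 0 (P.sparseYes ans s ρ x y) T =
      ∑ ρ, ∑ σ, q.payoff (P.input ρ σ) ∅ 0 (P.sparseYes ans s ρ x' y') T := by
  simp only [Finset.mem_offDiag, Finset.mem_erase] at h h'
  obtain ⟨⟨hxu, hxS⟩, ⟨hyu, hyS⟩, hxy⟩ := h
  obtain ⟨⟨hxu', hxS'⟩, ⟨hyu', hyS'⟩, hxy'⟩ := h'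
  set z := Equiv.swap x x' y with hz
  have hzS : z ∈ P.S := (swap_mem_iff (iff_of_true hxS hxS') y).2 hyS
  have hzx : x' ≠ z := by
    intro he
    refine hxy ((Equiv.swap x x').injective ?_)
    rw [Equiv.swap_apply_left, ← hz, ← he]
  have hzu : z ≠ P.u 0 := by
    rw [hz, ← Equiv.swap_apply_of_ne_of_ne hxu.symm hxu'.symm]
    exact (Equiv.swap x x').injective.ne hyu
  set g : Equiv.Perm (Fin n) := Equiv.swap z y' * Equiv.swap x x' with hg
  have hgx : g x = x' := by
    rw [hg, Equiv.Perm.mul_apply, Equiv.swap_apply_left, Equiv.swap_apply_of_ne_of_ne hzx hxy']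
  have hgy : g y = y' := by
    rw [hg, Equiv.Perm.mul_apply, ← hz, Equiv.swap_apply_left]
  have hgu : g (P.u 0) = P.u 0 := by
    rw [hg, Equiv.Perm.mul_apply, Equiv.swap_apply_of_ne_of_ne hxu.symm hxu'.symm,
      Equiv.swap_apply_of_ne_of_ne hzu.symm hyu'.symm]
  have hv {w : Fin n} (hw : w ∈ P.S) : P.v 0 ≠ w := (ne_of_mem_of_not_mem hw P.v_zero).symm
  have hgv : g (P.v 0) = P.v 0 := by
    rw [hg, Equiv.Perm.mul_apply, Equiv.swap_apply_of_ne_of_ne (hv hxS) (hv hxS'),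
      Equiv.swap_apply_of_ne_of_ne (hv hzS) (hv hyS')]
  have hgS : P.S.map g.toEmbedding = P.S := map_eq_of_mem_iff fun w => by
    rw [hg, Equiv.Perm.mul_apply, swap_mem_iff (iff_of_true hzS hyS'),
      swap_mem_iff (iff_of_true hxS hxS')]
  have hgS' (ρ : Equiv.Perm (Fin n)) :
      P.S.map (ρ * g).toEmbedding = P.S.map ρ.toEmbedding := by
    conv_rhs => rw [← hgS, Finset.map_map]
    rfl
  have hsparse (ρ : Equiv.Perm (Fin n)) :
      P.sparseYes ans s (ρ * g) x y = P.sparseYes ans s ρ x' y' := by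
    have hm (w : Fin n) : (ρ * g) w = ρ (g w) := rfl
    funext d
    unfold sparseYes
    rw [hgS', hm, hm, hm, hm, hgx, hgy, hgu, hgv]
  rw [← sum_mul_right g]
  simp only [input, hsparse, Equiv.Perm.mul_apply, hgu, hgv, hgS']

theorem sum_payoff_sparseYes_le {D : Type} (ans : D → Fin n → Fin n → Bool) (s : ℝ)
    (q : Preprocessing n D) (T : ℕ) {i : Fin (k + 1)} (hi : i ≠ 0) :
    ((P.S.erase (P.u 0)).offDiag.card : ℝ) *
        ∑ ρ, ∑ σ, q.payoff (P.input ρ σ) ∅ 0 (P.sparseYes ans s ρ (P.u i) (P.v i)) T ≤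
      Fintype.card (Equiv.Perm (Fin n)) * Fintype.card (Fin n → Equiv.Perm (Fin n)) *
        (2 * |s|) := by
  have hmem : (P.u i, P.v i) ∈ (P.S.erase (P.u 0)).offDiag := by
    simp only [Finset.mem_offDiag, Finset.mem_erase]
    exact ⟨⟨P.u_inj.ne hi, P.u_mem i⟩, ⟨(P.u_ne_v _ _).symm, P.v_mem i hi⟩, P.u_ne_v _ _⟩
  calc _ = ∑ z ∈ (P.S.erase (P.u 0)).offDiag, ∑ ρ, ∑ σ,
        q.payoff (P.input ρ σ) ∅ 0 (P.sparseYes ans s ρ z.1 z.2) T := by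
        rw [Finset.sum_congr rfl fun z hz => P.sum_payoff_sparseYes_eq ans s q T hz hmem]
        simp
    _ = ∑ ρ, ∑ σ, q.payoff (P.input ρ σ) ∅ 0
        (fun d => ∑ z ∈ (P.S.erase (P.u 0)).offDiag, P.sparseYes ans s ρ z.1 z.2 d) T := by
        rw [Finset.sum_comm]
        refine Finset.sum_congr rfl fun ρ _ => ?_
        rw [Finset.sum_comm]
        exact Finset.sum_congr rfl fun σ _ => (Preprocessing.payoff_sum _ _ _ _ q T).symm
    _ ≤ ∑ ρ : Equiv.Perm (Fin n), ∑ σ : Fin n → Equiv.Perm (Fin n), 2 * |s| := by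
        gcongr with ρ _ σ _
        exact Preprocessing.payoff_le _ _ (by positivity) (by positivity)
          (P.sum_sparseYes_le ans s ρ) q T
    _ = _ := by simp [mul_assoc]

/-- Without the bridge, a random vertex of one side is unlikely to be touched. -/
theorem sum_touch_vertex_le {D : Type} (q : Preprocessing n D) (T : ℕ) {A : Finset (Fin n)}
    (hA : ∀ x ∈ A, ∀ y ∈ A, (x ∈ P.S ↔ y ∈ P.S)) {r : Fin n} (hr : r ∈ A) (w : Fin n) :
    (A.card : ℝ) * ∑ ρ : Equiv.Perm (Fin n), ∑ σ, q.payoff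
        (twoCliquesInput (P.S.map ρ.toEmbedding) w w σ) {ρ r} 1 (fun _ => 0) T ≤
      Fintype.card (Equiv.Perm (Fin n)) * Fintype.card (Fin n → Equiv.Perm (Fin n)) *
        (2 * T) := by
  have h (x : Fin n) (hx : x ∈ A) :
      ∑ ρ : Equiv.Perm (Fin n), ∑ σ, q.payoff
        (twoCliquesInput (P.S.map ρ.toEmbedding) w w σ) {ρ x} 1 (fun _ => 0) T =
      ∑ ρ : Equiv.Perm (Fin n), ∑ σ, q.payoff
        (twoCliquesInput (P.S.map ρ.toEmbedding) w w σ) {ρ r} 1 (fun _ => 0) T := by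
    -- With the degenerate bridge `w w`, a swap within one side leaves the input unchanged.
    rw [← sum_mul_right (Equiv.swap x r)]
    have hS (ρ : Equiv.Perm (Fin n)) :
        P.S.map (ρ * Equiv.swap x r).toEmbedding = P.S.map ρ.toEmbedding := by
      conv_rhs => rw [← map_eq_of_mem_iff (swap_mem_iff (hA x hx r hr)), Finset.map_map]
      rfl
    simp only [hS, Equiv.Perm.mul_apply, Equiv.swap_apply_left]
  calc _ = ∑ x ∈ A, ∑ ρ : Equiv.Perm (Fin n), ∑ σ, q.payoff
        (twoCliquesInput (P.S.map ρ.toEmbedding) w w σ) {ρ x} 1 (fun _ => 0) T := by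
        rw [Finset.sum_congr rfl h]; simp
    _ ≤ ∑ x, ∑ ρ : Equiv.Perm (Fin n), ∑ σ, q.payoff
        (twoCliquesInput (P.S.map ρ.toEmbedding) w w σ) {ρ x} 1 (fun _ => 0) T :=
        Finset.sum_le_sum_of_subset_of_nonneg (Finset.subset_univ A) fun x _ _ =>
          Finset.sum_nonneg fun ρ _ => Finset.sum_nonneg fun σ _ =>
            Preprocessing.payoff_nonneg _ _ zero_le_one (fun _ => le_rfl) q T
    _ = ∑ ρ : Equiv.Perm (Fin n), ∑ σ, ∑ x, q.payoff
        (twoCliquesInput (P.S.map ρ.toEmbedding) w w σ) {ρ x} 1 (fun _ => 0) T := by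
        rw [Finset.sum_comm]
        exact Finset.sum_congr rfl fun ρ _ => Finset.sum_comm
    _ ≤ ∑ ρ : Equiv.Perm (Fin n), ∑ σ : Fin n → Equiv.Perm (Fin n), 2 * (T : ℝ) := by
        gcongr with ρ _ σ _
        exact (Equiv.sum_comp ρ fun x => q.payoff
          (twoCliquesInput (P.S.map ρ.toEmbedding) w w σ) {x} 1 (fun _ => 0) T).trans_le
          (Preprocessing.sum_touch_le _ q T)
    _ = _ := by simp [mul_assoc]

/-- Both bridge endpoints are among the vertices, so deleting the bridge is unnoticed before the
first touch. A union bound over single vertices follows. -/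
theorem sum_touch_verts_le {D : Type} (q : Preprocessing n D) (T : ℕ)
    (hS : P.S.card ≤ P.Sᶜ.card) :
    (P.S.card : ℝ) * ∑ ρ, ∑ σ, q.payoff (P.input ρ σ) (P.verts.map ρ.toEmbedding) 1
        (fun _ => 0) T ≤
      (2 * k + 2) * (Fintype.card (Equiv.Perm (Fin n)) *
        Fintype.card (Fin n → Equiv.Perm (Fin n)) * (2 * T)) := by
  have h1 (ρ : Equiv.Perm (Fin n)) (σ : Fin n → Equiv.Perm (Fin n)) :
      q.payoff (P.input ρ σ) (P.verts.map ρ.toEmbedding) 1 (fun _ => 0) T ≤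
      ∑ r ∈ P.verts, q.payoff
        (twoCliquesInput (P.S.map ρ.toEmbedding) (P.u 0) (P.u 0) σ) {ρ r} 1 (fun _ => 0) T := by
    have h := agreeOff_twoCliquesInput (R := P.verts.map ρ.toEmbedding)
      (S := P.S.map ρ.toEmbedding) (a := ρ (P.u 0)) (b := ρ (P.v 0)) σ (Equiv.refl _)
      (fun _ _ => rfl) (Or.inr ⟨by simpa using P.u_mem_verts 0, by simpa using P.v_mem_verts 0⟩)
      (Or.inl (rfl : P.u 0 = P.u 0))
    simp only [Equiv.refl_toEmbedding, Finset.map_refl, Equiv.trans_refl] at h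
    rw [input, h.payoff_eq]
    refine (Preprocessing.touch_le_sum _ _ q T).trans_eq ?_
    rw [Finset.sum_map]
    rfl
  have h2 (r : Fin n) : (P.S.card : ℝ) * ∑ ρ : Equiv.Perm (Fin n), ∑ σ, q.payoff
        (twoCliquesInput (P.S.map ρ.toEmbedding) (P.u 0) (P.u 0) σ) {ρ r} 1 (fun _ => 0) T ≤
      Fintype.card (Equiv.Perm (Fin n)) * Fintype.card (Fin n → Equiv.Perm (Fin n)) *
        (2 * T) := by
    by_cases hr : r ∈ P.S
    · exact P.sum_touch_vertex_le q T (fun x hx y hy => iff_of_true hx hy) hr _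
    -- A vertex outside `S` is uniform on a side at least as large as `S`.
    · refine le_trans ?_ (P.sum_touch_vertex_le q T (A := P.Sᶜ) (fun x hx y hy =>
        iff_of_false (Finset.mem_compl.1 hx) (Finset.mem_compl.1 hy))
        (Finset.mem_compl.2 hr) (P.u 0))
      gcongr
      exact Finset.sum_nonneg fun ρ _ => Finset.sum_nonneg fun σ _ =>
        Preprocessing.payoff_nonneg _ _ zero_le_one (fun _ => le_rfl) q T
  have hcard : (P.verts.card : ℝ) ≤ 2 * k + 2 := by
    have : P.verts.card ≤ (k + 1) + (k + 1) :=
      (Finset.card_union_le _ _).trans (add_le_add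
        (Finset.card_image_le.trans_eq (by simp)) (Finset.card_image_le.trans_eq (by simp)))
    calc (P.verts.card : ℝ) ≤ (((k + 1) + (k + 1) : ℕ) : ℝ) := by exact_mod_cast this
      _ = 2 * k + 2 := by push_cast; ring
  calc _ ≤ (P.S.card : ℝ) * ∑ ρ : Equiv.Perm (Fin n), ∑ σ, ∑ r ∈ P.verts, q.payoff
        (twoCliquesInput (P.S.map ρ.toEmbedding) (P.u 0) (P.u 0) σ) {ρ r} 1 (fun _ => 0) T := by
        gcongr with ρ _ σ _
        exact h1 ρ σ
    _ = ∑ r ∈ P.verts, (P.S.card : ℝ) * ∑ ρ : Equiv.Perm (Fin n), ∑ σ, q.payoff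
        (twoCliquesInput (P.S.map ρ.toEmbedding) (P.u 0) (P.u 0) σ) {ρ r} 1 (fun _ => 0) T := by
        rw [← Finset.mul_sum, Finset.sum_comm (s := P.verts)]
        congr 1
        refine Finset.sum_congr rfl fun ρ _ => Finset.sum_comm
    _ ≤ ∑ r ∈ P.verts, (Fintype.card (Equiv.Perm (Fin n)) *
        Fintype.card (Fin n → Equiv.Perm (Fin n)) * (2 * T) : ℝ) :=
        Finset.sum_le_sum fun r _ => h2 r
    _ ≤ _ := by
        rw [Finset.sum_const, nsmul_eq_mul]
        gcongr

end PairTemplate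

/-! ### Combining the three bounds -/

namespace PairTemplate

variable {n k : ℕ} (P : PairTemplate n k)

/-- A spanning oracle answers positively on the bridge, so that it is counted by one of the
indicators of the right-hand side. -/
theorem payoff_input_le (A : OracleAlgorithm n) (s : ℝ) (T : ℕ) (ρ : Equiv.Perm (Fin n))
    (σ : Fin n → Equiv.Perm (Fin n)) :
    A.successProb s T (P.input ρ σ) ≤
      A.preprocess.payoff (P.input ρ σ) (P.verts.map ρ.toEmbedding) 0
        (P.onlyFirst A.answer ρ) T +
      A.preprocess.payoff (P.input ρ σ) (P.verts.map ρ.toEmbedding) 1 (fun _ => 0) T +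
      ∑ i ∈ Finset.univ.erase 0, A.preprocess.payoff (P.input ρ σ) ∅ 0
        (P.sparseYes A.answer s ρ (P.u i) (P.v i)) T := by
  classical
  have h0 (d) : 0 ≤ P.onlyFirst A.answer ρ d := by unfold onlyFirst; split_ifs <;> simp
  have h1 (d) : P.onlyFirst A.answer ρ d ≤ 1 := by unfold onlyFirst; split_ifs <;> simp
  have h2 (i d) : 0 ≤ P.sparseYes A.answer s ρ (P.u i) (P.v i) d := by
    unfold sparseYes; split_ifs <;> simp
  have key (d : A.Data) :
      (if IsSpanningOracle (P.input ρ σ).graph s (A.answer d) then (1 : ℝ) else 0) ≤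
      P.onlyFirst A.answer ρ d +
        ∑ i ∈ Finset.univ.erase 0, P.sparseYes A.answer s ρ (P.u i) (P.v i) d := by
    have hsum : 0 ≤ ∑ i ∈ Finset.univ.erase 0, P.sparseYes A.answer s ρ (P.u i) (P.v i) d :=
      Finset.sum_nonneg fun i _ => h2 i d
    split_ifs with hd
    · have hbridge := hd.answer_bridge (S := P.S.map ρ.toEmbedding) (by simpa using P.u_mem 0)
        (by simpa using P.v_zero)
      by_cases hi : ∃ i, i ≠ 0 ∧ A.answer d (ρ (P.u i)) (ρ (P.v i)) = true
      · obtain ⟨i, hi0, hi⟩ := hi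
        have hle := Finset.single_le_sum (fun j _ => h2 j d)
          (Finset.mem_erase.2 ⟨hi0, Finset.mem_univ i⟩)
        have hone : P.sparseYes A.answer s ρ (P.u i) (P.v i) d = 1 := by
          unfold sparseYes
          rw [if_pos]
          exact ⟨hd.card_le, hi⟩
        rw [hone] at hle
        linarith [h0 d]
      · push Not at hi
        have hone : P.onlyFirst A.answer ρ d = 1 := by
          unfold onlyFirst
          rw [if_pos]
          exact ⟨hbridge, hi⟩
        linarith
    · linarith [h0 d]
  rw [OracleAlgorithm.successProb, Preprocessing.run_toReal (P.input ρ σ)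
    fun d => IsSpanningOracle (P.input ρ σ).graph s (A.answer d)]
  refine (Preprocessing.payoff_mono _ _ le_rfl key _ T).trans ?_
  have hadd := Preprocessing.payoff_add (P.input ρ σ) ∅ 0 0 (P.onlyFirst A.answer ρ)
    (fun d => ∑ i ∈ Finset.univ.erase 0, P.sparseYes A.answer s ρ (P.u i) (P.v i) d)
    A.preprocess T
  rw [add_zero, Preprocessing.payoff_sum] at hadd
  rw [hadd]
  gcongr
  refine (Preprocessing.payoff_empty_le _ (P.verts.map ρ.toEmbedding) 0 h1 _ T).trans_eq ?_
  simpa using Preprocessing.payoff_add (P.input ρ σ) (P.verts.map ρ.toEmbedding) 0 1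
    (P.onlyFirst A.answer ρ) (fun _ => 0) A.preprocess T

theorem cut_mem (hS : P.S.card = n / 2) : (P.S, P.u 0, P.v 0) ∈ cliqueCuts n := by
  simp [cliqueCuts, hS, P.u_mem, P.v_zero]

theorem cliqueSuccessProb_mul (A : OracleAlgorithm n) (s : ℝ) (T : ℕ) (hS : P.S.card = n / 2) :
    A.cliqueSuccessProb s T *
        (Fintype.card (Equiv.Perm (Fin n)) * Fintype.card (Fin n → Equiv.Perm (Fin n))) =
      ∑ ρ, ∑ σ, A.successProb s T (P.input ρ σ) := by
  have h := sum_cliqueCuts (P.cut_mem hS) fun z =>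
    ∑ σ, A.successProb s T (twoCliquesInput z.1 z.2.1 z.2.2 σ)
  have h1 : ((cliqueCuts n).card : ℝ) ≠ 0 :=
    Nat.cast_ne_zero.2 (Finset.card_ne_zero_of_mem (P.cut_mem hS))
  have h2 : (Fintype.card (Fin n → Equiv.Perm (Fin n)) : ℝ) ≠ 0 :=
    Nat.cast_ne_zero.2 Fintype.card_ne_zero
  have h3 : ∑ ρ, ∑ σ, A.successProb s T (P.input ρ σ) =
      ∑ ρ, ∑ σ, A.successProb s T (twoCliquesInput (relabel ρ (P.S, P.u 0, P.v 0)).1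
        (relabel ρ (P.S, P.u 0, P.v 0)).2.1 (relabel ρ (P.S, P.u 0, P.v 0)).2.2 σ) := rfl
  rw [OracleAlgorithm.cliqueSuccessProb, div_mul_eq_mul_div, div_eq_iff (mul_ne_zero h1 h2), h3]
  linear_combination (Fintype.card (Fin n → Equiv.Perm (Fin n)) : ℝ) * h

theorem le_of_le_cliqueSuccessProb (A : OracleAlgorithm n) {p s : ℝ} (T : ℕ)
    (hS : P.S.card = n / 2) (hp : p ≤ A.cliqueSuccessProb s T) (hk : 4 ≤ p * (k + 1))
    (hs : 8 * k * |s| ≤ p * (P.S.erase (P.u 0)).offDiag.card)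
    (hcard : 0 < (P.S.erase (P.u 0)).offDiag.card) :
    p * (n / 2 : ℕ) ≤ 8 * (k + 1) * T := by
  have hmul := P.cliqueSuccessProb_mul A s T hS
  have hX1 := P.sum_payoff_onlyFirst_le A.answer A.preprocess T
  have hX2 (i : Fin (k + 1)) (hi : i ≠ 0) :=
    P.sum_payoff_sparseYes_le A.answer s A.preprocess T hi
  have hX3 := P.sum_touch_verts_le A.preprocess T (by
    rw [Finset.card_compl, Fintype.card_fin, hS]; omega)
  set K : ℝ := Fintype.card (Equiv.Perm (Fin n)) * Fintype.card (Fin n → Equiv.Perm (Fin n))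
    with hK
  have hK0 : 0 < K := by
    have h1 : 0 < Fintype.card (Equiv.Perm (Fin n)) := Fintype.card_pos
    have h2 : 0 < Fintype.card (Fin n → Equiv.Perm (Fin n)) := Fintype.card_pos
    positivity
  set X1 := ∑ ρ, ∑ σ, A.preprocess.payoff (P.input ρ σ) (P.verts.map ρ.toEmbedding) 0
    (P.onlyFirst A.answer ρ) T with hX1def
  set X3 := ∑ ρ, ∑ σ, A.preprocess.payoff (P.input ρ σ) (P.verts.map ρ.toEmbedding) 1
    (fun _ => 0) T with hX3def
  set C : ℝ := ((P.S.erase (P.u 0)).offDiag.card : ℝ) with hC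
  have hC0 : 0 < C := Nat.cast_pos.2 hcard
  have hX2' (i : Fin (k + 1)) (hi : i ∈ Finset.univ.erase 0) :
      ∑ ρ, ∑ σ, A.preprocess.payoff (P.input ρ σ) ∅ 0
        (P.sparseYes A.answer s ρ (P.u i) (P.v i)) T ≤ K * (2 * |s|) / C := by
    rw [le_div_iff₀ hC0, mul_comm]
    exact hX2 i (Finset.ne_of_mem_erase hi)
  have htotal : A.cliqueSuccessProb s T * K ≤ X1 + X3 + k * (K * (2 * |s|) / C) := by
    rw [hmul]
    calc _ ≤ _ := Finset.sum_le_sum fun ρ _ => Finset.sum_le_sum fun σ _ =>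
          P.payoff_input_le A s T ρ σ
      _ = X1 + X3 + ∑ i ∈ Finset.univ.erase 0, ∑ ρ, ∑ σ, A.preprocess.payoff (P.input ρ σ) ∅ 0
            (P.sparseYes A.answer s ρ (P.u i) (P.v i)) T := by
          simp only [Finset.sum_add_distrib]
          congr 1
          rw [Finset.sum_comm (s := Finset.univ.erase 0)]
          exact Finset.sum_congr rfl fun ρ _ => Finset.sum_comm
      _ ≤ _ := by
          gcongr
          refine (Finset.sum_le_sum hX2').trans_eq ?_
          simp
  -- Events (1) and (2) account for at most `p / 4` each, which leaves at least `p / 2` for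
  -- touching.
  have hb1 : 4 * X1 ≤ p * K := by
    have hk1 : (0 : ℝ) < k + 1 := by positivity
    refine le_of_mul_le_mul_left ?_ hk1
    nlinarith
  have hb2 : 4 * (k * (K * (2 * |s|) / C)) ≤ p * K := by
    rw [← mul_div_assoc, ← mul_div_assoc, div_le_iff₀ hC0]
    nlinarith
  have hpK : p * K ≤ A.cliqueSuccessProb s T * K := by gcongr
  have hb3 : p * K ≤ 2 * X3 := by linarith
  rw [hS] at hX3
  have hm0 : (0 : ℝ) ≤ (n / 2 : ℕ) := Nat.cast_nonneg _
  refine le_of_mul_le_mul_right ?_ hK0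
  nlinarith [mul_le_mul_of_nonneg_left hb3 hm0]

end PairTemplate

/-! ### Existence of templates and choice of constants -/

/-- `S` is an initial segment containing the pairs `(i, k + i)` for `1 ≤ i ≤ k`; the first pair is
`(0, n / 2)`. -/
theorem exists_pairTemplate {n k : ℕ} (h : 2 * k + 1 ≤ n / 2) :
    ∃ P : PairTemplate n k, P.S.card = n / 2 := by
  have hi (i : Fin (k + 1)) : (i : ℕ) ≤ k := Nat.lt_succ_iff.1 i.2
  have h0 {i : Fin (k + 1)} : i ≠ 0 ↔ (i : ℕ) ≠ 0 := Fin.val_ne_zero_iff.symm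
  refine ⟨{ S := Finset.univ.filter fun w : Fin n => (w : ℕ) < n / 2
            u := fun i => ⟨i, by have := hi i; omega⟩
            v := fun i => ⟨if (i : ℕ) = 0 then n / 2 else k + i, by
              have := hi i; split_ifs <;> omega⟩
            u_mem := fun i => by have := hi i; simp; omega
            v_mem := fun i h => by
              have := hi i
              rw [h0] at h
              simp only [Finset.mem_filter, Finset.mem_univ, true_and, if_neg h]
              omega
            v_zero := by simp
            u_inj := fun i j hij => by simpa [Fin.ext_iff] using hij
            v_inj := fun i j hij => by
              have := hi i
              have := hi j
              simp only [Fin.mk.injEq] at hij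
              ext
              split_ifs at hij <;> omega
            u_ne_v := fun i j => by
              have := hi i
              have := hi j
              simp only [ne_eq, Fin.mk.injEq]
              split_ifs <;> omega }, ?_⟩
  rw [Fin.card_filter_val_lt]
  omega

theorem le_cliqueSuccessProb_of_forall {n : ℕ} (A : OracleAlgorithm n) {p s : ℝ} {T : ℕ}
    (hcuts : (cliqueCuts n).Nonempty) (h : ∀ I : GraphInput n, p ≤ A.successProb s T I) :
    p ≤ A.cliqueSuccessProb s T := by
  have h1 : 0 < (cliqueCuts n).card := hcuts.card_pos
  have h2 : 0 < Fintype.card (Fin n → Equiv.Perm (Fin n)) := Fintype.card_pos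
  rw [OracleAlgorithm.cliqueSuccessProb, le_div_iff₀ (by positivity)]
  calc p * ((cliqueCuts n).card * Fintype.card (Fin n → Equiv.Perm (Fin n)))
      = ∑ x ∈ cliqueCuts n, ∑ σ : Fin n → Equiv.Perm (Fin n), p := by simp; ring
    _ ≤ _ := Finset.sum_le_sum fun x _ => Finset.sum_le_sum fun σ _ => h _

theorem mainTheorem3 (p : ℝ) (hp : 0 < p) :
    ∃ c : ℝ, 0 < c ∧ ∀ s : ℕ → ℝ, (s =o[atTop] fun n : ℕ => (n : ℝ) ^ 2) →
      ∀ᶠ n : ℕ in atTop, ∀ (A : OracleAlgorithm n) (T : ℕ),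
        ((∀ I : GraphInput n, p ≤ A.successProb (s n) T I) → c * (n : ℝ) ≤ (T : ℝ)) ∧
        (p ≤ A.cliqueSuccessProb (s n) T → c * (n : ℝ) ≤ (T : ℝ)) := by
  obtain ⟨k, hk⟩ := exists_nat_gt (4 / p)
  rw [div_lt_iff₀ hp] at hk
  -- Touching yields `p * (n / 2 : ℕ) ≤ 8 * (k + 1) * T`, and `n ≤ 3 * (n / 2 : ℕ)` for large `n`.
  refine ⟨p / (24 * (k + 1)), by positivity, fun s hs => ?_⟩
  -- `128 = 8 * 16`: the `8` is from the bound on event (2), and the `16` from the at least `n ^ 2 /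
  -- 16` candidate pairs for a decoy.
  have hε : 0 < p / (128 * (k + 1)) := by positivity
  filter_upwards [hs.def hε, eventually_ge_atTop (4 * k + 12)] with n hsn hn A T
  obtain ⟨P, hP⟩ := exists_pairTemplate (n := n) (k := k) (by omega)
  have key (h : p ≤ A.cliqueSuccessProb (s n) T) : p / (24 * (k + 1)) * (n : ℝ) ≤ T := by
    have hn12 : (12 : ℝ) ≤ n := by exact_mod_cast (by omega : 12 ≤ n)
    have hhalf : (n : ℝ) ≤ 2 * (n / 2 : ℕ) + 1 := by
      exact_mod_cast (by omega : n ≤ 2 * (n / 2) + 1)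
    have hC : ((P.S.erase (P.u 0)).offDiag.card : ℝ) =
        ((n / 2 : ℕ) - 1) * ((n / 2 : ℕ) - 2) := by
      rw [Finset.offDiag_card, Finset.card_erase_of_mem (P.u_mem 0), hP]
      obtain ⟨m, hm⟩ : ∃ m, n / 2 = m + 2 := ⟨n / 2 - 2, by omega⟩
      rw [hm, show m + 2 - 1 = m + 1 by omega, show (m + 1) * (m + 1) - (m + 1) = (m + 1) * m by
        rw [Nat.mul_succ, Nat.add_sub_cancel]]
      push_cast
      ring
    have hC16 : (n : ℝ) ^ 2 ≤ 16 * (P.S.erase (P.u 0)).offDiag.card := by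
      rw [hC]
      nlinarith
    have hs8 : 8 * k * |s n| ≤ p * (P.S.erase (P.u 0)).offDiag.card := by
      rw [Real.norm_eq_abs, Real.norm_eq_abs, abs_of_nonneg (by positivity : (0 : ℝ) ≤ n ^ 2),
        div_mul_eq_mul_div, le_div_iff₀ (by positivity)] at hsn
      have := mul_le_mul_of_nonneg_left hC16 hp.le
      nlinarith [abs_nonneg (s n)]
    have hpos : 0 < (P.S.erase (P.u 0)).offDiag.card := by
      have : (0 : ℝ) < (P.S.erase (P.u 0)).offDiag.card := by nlinarith
      exact_mod_cast this
    have hmain := P.le_of_le_cliqueSuccessProb A T hP h (by linarith) hs8 hpos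
    rw [div_mul_eq_mul_div, div_le_iff₀ (by positivity)]
    have : p * n ≤ p * (3 * (n / 2 : ℕ)) := by
      gcongr
      linarith
    linarith
  exact ⟨fun h => key (le_cliqueSuccessProb_of_forall A ⟨_, P.cut_mem hP⟩ h), key⟩
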